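/- **Setting.** Let $n,m\ge 0$, $N\ge 1$, $T\ge 1$, $\mathcal I=\{1,\dots,N\}$. Consider $x[t+1]=Ax[t]+\sum_{i\in\mathcal I}B_iu_i[t]$ with $A\in\mathbb R^{n\times n}$, $B_i\in\mathbb R^{n\times m}$, and let $\phi[t|x_0,\boldsymbol u]$, $t=0,\dots,T$, be its state sequence from $x_0$ under $\boldsymbol u=(u_i)_{i\in\mathcal I}$. The constraints are $x[t]\in\mathbb X\subseteq\mathbb R^n$ and $u_i[t]\in\mathbb U_i(\boldsymbol u_{-i}[t])\subseteq\mathbb R^m$, the stage costs $\ell_i(x,u_i)=\tfrac12 x^\top Q_ix+\tfrac12u_i^\top R_iu_i$. Write $S_i=B_iR_i^{-1}B_i^\top$, and call a matrix Schur if all its eigenvalues have modulus $<1$. Assume: 1. $0\in\operatorname{int}\mathbb X$, and $0\in\operatorname{int}\mathbb U_i(0)$, $Q_i=C_i^\top C_i$, $R_i=R_i^\top\succ0$ for all $i$; 2. $A$ is invertible, and for all $i$ the pair $(A,B_i)$ is stabilizable and $(A,C_i)$ is detectable; 3. the matrix $$H=\begin{bmatrix}A+\sum_jS_jA^{-\top}Q_j&\operatorname{row}(-S_jA^{-\top})_j\\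 \operatorname{col}(-A^{-\top}Q_j)_j&I_N\otimes A^{-\top}\end{bmatrix}$$ has exactly $n$ eigenvalues (with multiplicity) of modulus $<1$, and an $n$-dimensional stable invariant subspace of $H$ is complementary to $\operatorname{Im}\begin{bmatrix}0\\I_{Nn}\end{bmatrix}$. Let $(P_i^{OL},K_i^{OL})_{i\in\mathcal I}$ be a stabilizing solution of the coupled Riccati equations $$P_i^{OL}=Q_i+A^\top P_i^{OL}\bar A,\qquad K_i^{OL}=-R_i^{-1}B_i^\top P_i^{OL}\bar A,\qquad \bar A:=A+\sum_{j\in\mathcal I}B_jK_j^{OL},$$ that is, a solution for which $\bar A$ is Schur. For each $i$ put $$\widehat A_i=\begin{bmatrix}A&\sum_{j\ne i}B_jK_j^{OL}\\0&\bar A\end{bmatrix},\quad\widehat B_i=\begin{bmatrix}B_i\\0\end{bmatrix},\quad\widehat Q_i=\begin{bmatrix}Q_i&0\\0&0\end{bmatrix},$$ let $\widehat P_i\succcurlyeq0$ solve $\widehat P_i=\widehat Q_i+\widehat A_i^\top\widehat P_i(\widehat A_i+\widehat B_i\widehat K_i)$ with $\widehat K_i=-(R_i+\widehat B_i^\top\widehat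 P_i\widehat B_i)^{-1}\widehat B_i^\top\widehat P_i\widehat A_i$, and let $V_i(x,y)=\tfrac12\begin{bmatrix}x\\y\end{bmatrix}^\top\widehat P_i\begin{bmatrix}x\\y\end{bmatrix}$. **Finite-horizon problem at $x_0$.** Let $\mathcal U_{i,T}(x_0,\boldsymbol u_{-i})$ be the set of sequences $u_i$ of length $T$ with $u_i[t]\in\mathbb U_i(\boldsymbol u_{-i}[t])$ for $0\le t\le T-1$ and $\phi[t|x_0,u_i,\boldsymbol u_{-i}]\in\mathbb X$ for $1\le t\le T$. A collective sequence $\boldsymbol u$ of length $T$ solves the problem at $x_0\in\mathbb X$ if, for every $i$, $u_i$ minimizes over $v_i\in\mathcal U_{i,T}(x_0,\boldsymbol u_{-i})$ the cost $$J_i(v_i|x_0,\boldsymbol u)=\sum_{t=0}^{T-1}\ell_i\big(\phi[t|x_0,v_i,\boldsymbol u_{-i}],v_i[t]\big)+V_i\big(\phi[T|x_0,v_i,\boldsymbol u_{-i}],\phi[T|x_0,\boldsymbol u]\big).$$ Let $\mathbb X_f\subseteq\mathbb X$ be a constraints-admissible forward invariant set for $x\mapsto\bar Ax$: for all $x\in\mathbb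 X_f$, $\bar Ax\in\mathbb X_f$ and $K_i^{OL}x\in\mathbb U_i\big((K_j^{OL}x)_{j\ne i}\big)$ for all $i$. Let $\mathcal X$ be the set of $x_0\in\mathbb X$ at which the problem has a solution $\boldsymbol u$ with $\phi[T|x_0,\boldsymbol u]\in\mathbb X_f$. **Lemma.** Let $x_0\in\mathcal X$, let $\boldsymbol u^{FH}$ be a solution at $x_0$ with $\phi[T|x_0,\boldsymbol u^{FH}]\in\mathbb X_f$, and let $x^{FH}=\phi(x_0,\boldsymbol u^{FH})$. Define $$u_i^{SH}[t]=\begin{cases}u_i^{FH}[t+1]&t<T-1,\\K_i^{OL}x^{FH}[T]&t=T-1.\end{cases}$$ Then $x^{FH}[1]\in\mathbb X$, and $\boldsymbol u^{SH}$ solves the finite-horizon problem at $x^{FH}[1]$. -/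

import Mathlib

open Matrix

noncomputable section

/-- The weighted squared norm `‖x‖²_M = xᵀ M x`. -/
def wsq {α : Type*} [Fintype α] (M : Matrix α α ℝ) (x : α → ℝ) : ℝ := x ⬝ᵥ (M *ᵥ x)

/-- A real square matrix is Schur if all its complex eigenvalues have modulus less than one. -/
def IsSchur {α : Type*} [Fintype α] [DecidableEq α] (M : Matrix α α ℝ) : Prop :=
  ∀ μ ∈ spectrum ℂ (M.map (algebraMap ℝ ℂ)), ‖μ‖ < 1

def IsStabilizable {n m : ℕ} (A : Matrix (Fin n) (Fin n) ℝ) (B : Matrix (Fin n) (Fin m) ℝ) :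
    Prop := ∃ F : Matrix (Fin m) (Fin n) ℝ, IsSchur (A + B * F)

def IsDetectable {n p : ℕ} (A : Matrix (Fin n) (Fin n) ℝ) (C : Matrix (Fin p) (Fin n) ℝ) :
    Prop := ∃ L : Matrix (Fin n) (Fin p) ℝ, IsSchur (A + L * C)

/-- Data of a constrained linear-quadratic dynamic game: `n` states, `N` agents with `m` inputs
each. `U i w` is the set of admissible inputs of agent `i` when the inputs of the other agents
are `w`. -/
structure LQGame (n m N : ℕ) where
  A : Matrix (Fin n) (Fin n) ℝ
  B : Fin N → Matrix (Fin n) (Fin m) ℝ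
  Q : Fin N → Matrix (Fin n) (Fin n) ℝ
  R : Fin N → Matrix (Fin m) (Fin m) ℝ
  /-- number of rows of `C i` -/
  p : Fin N → ℕ
  /-- the square root of the state weight, `Q i = (C i)ᵀ * C i` -/
  C : (i : Fin N) → Matrix (Fin (p i)) (Fin n) ℝ
  X : Set (Fin n → ℝ)
  U : (i : Fin N) → ({j : Fin N // j ≠ i} → Fin m → ℝ) → Set (Fin m → ℝ)

namespace LQGame

variable {n m N : ℕ} (G : LQGame n m N)

/-! ### Standing assumptions -/

/-- The origin is strictly feasible; the weights are positive semidefinite, resp. definite. -/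
structure Basic : Prop where
  zero_mem_X : (0 : Fin n → ℝ) ∈ interior G.X
  zero_mem_U : ∀ i, (0 : Fin m → ℝ) ∈ interior (G.U i 0)
  Q_eq : ∀ i, G.Q i = (G.C i)ᵀ * G.C i
  R_posDef : ∀ i, (G.R i).PosDef

/-- `A` is invertible, every `(A, B i)` is stabilizable and every `(A, C i)` is detectable. -/
structure Primitives : Prop where
  A_inv : IsUnit G.A
  stab : ∀ i, IsStabilizable G.A (G.B i)
  det : ∀ i, IsDetectable G.A (G.C i)

/-- `S i = B i (R i)⁻¹ (B i)ᵀ`. -/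
def S (i : Fin N) : Matrix (Fin n) (Fin n) ℝ := G.B i * (G.R i)⁻¹ * (G.B i)ᵀ

/-- The matrix
`[[A + ∑ j, S j A⁻ᵀ Q j, row (-S j A⁻ᵀ)], [col (-A⁻ᵀ Q j), I_N ⊗ A⁻ᵀ]]`. -/
def H : Matrix (Fin n ⊕ Fin N × Fin n) (Fin n ⊕ Fin N × Fin n) ℝ :=
  Matrix.fromBlocks
    (G.A + ∑ j, G.S j * (G.A⁻¹)ᵀ * G.Q j)
    (Matrix.of fun a jb => (-(G.S jb.1 * (G.A⁻¹)ᵀ)) a jb.2)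
    (Matrix.of fun ja b => (-((G.A⁻¹)ᵀ * G.Q ja.1)) ja.2 b)
    (Matrix.kroneckerMap (· * ·) (1 : Matrix (Fin N) (Fin N) ℝ) (G.A⁻¹)ᵀ)

/-- `H` has exactly `n` eigenvalues (with multiplicity) of modulus smaller than one, and an
`n`-dimensional stable invariant subspace of `H` is complementary to the image of `[0; I]`. -/
structure StructureH : Prop where
  card_stable :
    (((G.H.map (algebraMap ℝ ℂ)).charpoly.roots).filter fun μ => ‖μ‖ < 1).card = n
  compl : ∃ (W : Submodule ℝ (Fin n ⊕ Fin N × Fin n → ℝ))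
    (hW : ∀ w ∈ W, Matrix.toLin' G.H w ∈ W),
    Module.finrank ℝ W = n ∧
    (∀ μ ∈ ((Matrix.toLin' G.H).restrict hW).charpoly.aroots ℂ, ‖μ‖ < 1) ∧
    IsCompl W (LinearMap.range (Matrix.toLin'
      (Matrix.fromRows (0 : Matrix (Fin n) (Fin N × Fin n) ℝ) 1)))

/-! ### Riccati equations and the terminal cost -/

/-- `A + ∑ i, B i K i`. -/
def closedLoop (K : Fin N → Matrix (Fin m) (Fin n) ℝ) : Matrix (Fin n) (Fin n) ℝ :=
  G.A + ∑ i, G.B i * K i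

/-- `(P, K)` solves the coupled open-loop Nash Riccati equations. -/
def SolvesRiccatiOL (P : Fin N → Matrix (Fin n) (Fin n) ℝ)
    (K : Fin N → Matrix (Fin m) (Fin n) ℝ) : Prop :=
  ∀ i, P i = G.Q i + (G.A)ᵀ * P i * G.closedLoop K ∧
    K i = -((G.R i)⁻¹ * (G.B i)ᵀ * P i * G.closedLoop K)

/-- `[[A, ∑ j ≠ i, B j K j], [0, A + ∑ j, B j K j]]`. -/
def liftA (K : Fin N → Matrix (Fin m) (Fin n) ℝ) (i : Fin N) :
    Matrix (Fin n ⊕ Fin n) (Fin n ⊕ Fin n) ℝ :=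
  Matrix.fromBlocks G.A (∑ j ∈ Finset.univ.erase i, G.B j * K j) 0 (G.closedLoop K)

/-- `[B i; 0]`. -/
def liftB (i : Fin N) : Matrix (Fin n ⊕ Fin n) (Fin m) ℝ := Matrix.fromRows (G.B i) 0

/-- `[[Q i, 0], [0, 0]]`. -/
def liftQ (i : Fin N) : Matrix (Fin n ⊕ Fin n) (Fin n ⊕ Fin n) ℝ :=
  Matrix.fromBlocks (G.Q i) 0 0 0

/-- The gain `-(R i + B̂ᵀ P̂ B̂)⁻¹ B̂ᵀ P̂ Â` of the lifted regulator problem. -/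
def liftGain (K : Fin N → Matrix (Fin m) (Fin n) ℝ) (i : Fin N)
    (Phat : Matrix (Fin n ⊕ Fin n) (Fin n ⊕ Fin n) ℝ) : Matrix (Fin m) (Fin n ⊕ Fin n) ℝ :=
  -((G.R i + (G.liftB i)ᵀ * Phat * G.liftB i)⁻¹ * (G.liftB i)ᵀ * Phat * G.liftA K i)

/-- `Phat` is a positive semidefinite solution of the algebraic Riccati equation of the lifted
regulator problem of agent `i`: `P̂ = Q̂ + Âᵀ P̂ (Â + B̂ K̂)` with `K̂` the gain above. -/
def SolvesLiftedARE (K : Fin N → Matrix (Fin m) (Fin n) ℝ) (i : Fin N)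
    (Phat : Matrix (Fin n ⊕ Fin n) (Fin n ⊕ Fin n) ℝ) : Prop :=
  Phat.PosSemidef ∧
    Phat = G.liftQ i + (G.liftA K i)ᵀ * Phat * (G.liftA K i + G.liftB i * G.liftGain K i Phat)

/-- The terminal cost `½ ‖(x, y)‖²_{P̂}`. -/
def termCost (Phat : Matrix (Fin n ⊕ Fin n) (Fin n ⊕ Fin n) ℝ) (x y : Fin n → ℝ) : ℝ :=
  1 / 2 * wsq Phat (Sum.elim x y)

/-! ### The finite-horizon problem -/

variable {T : ℕ}

/-- The state sequence `φ[t | x₀, u]`, `t = 0, …, T`. -/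
def phi (x₀ : Fin n → ℝ) (u : Fin N → Fin T → Fin m → ℝ) : Fin (T + 1) → Fin n → ℝ :=
  Fin.induction x₀ fun t x => G.A *ᵥ x + ∑ i, G.B i *ᵥ u i t

/-- The stage cost. -/
def stage (i : Fin N) (x : Fin n → ℝ) (v : Fin m → ℝ) : ℝ :=
  1 / 2 * wsq (G.Q i) x + 1 / 2 * wsq (G.R i) v

/-- The feasible sequences of agent `i` given those of the other agents (the `i`-th component of
`u` plays no role). -/
def feas (i : Fin N) (x₀ : Fin n → ℝ) (u : Fin N → Fin T → Fin m → ℝ) :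
    Set (Fin T → Fin m → ℝ) :=
  {v | (∀ t, v t ∈ G.U i fun j => u j.1 t) ∧
    ∀ t : Fin T, G.phi x₀ (Function.update u i v) t.succ ∈ G.X}

/-- The cost `J_i(v | x₀, u)` of agent `i` for playing `v` instead of `u i`. The second argument
of the terminal cost is the terminal state under `u` itself. -/
def cost (Phat : Fin N → Matrix (Fin n ⊕ Fin n) (Fin n ⊕ Fin n) ℝ) (i : Fin N)
    (x₀ : Fin n → ℝ) (u : Fin N → Fin T → Fin m → ℝ) (v : Fin T → Fin m → ℝ) : ℝ :=
  (∑ t : Fin T, G.stage i (G.phi x₀ (Function.update u i v) t.castSucc) (v t)) +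
    termCost (Phat i) (G.phi x₀ (Function.update u i v) (Fin.last T))
      (G.phi x₀ u (Fin.last T))

/-- `u` solves the finite-horizon problem at `x₀`: for each agent `i`, the sequence `u i`
minimizes `J_i(· | x₀, u)` over the feasible set of agent `i` given the others' sequences. -/
def SolvesFH (Phat : Fin N → Matrix (Fin n ⊕ Fin n) (Fin n ⊕ Fin n) ℝ) (x₀ : Fin n → ℝ)
    (u : Fin N → Fin T → Fin m → ℝ) : Prop :=
  ∀ i, u i ∈ G.feas i x₀ u ∧
    ∀ v ∈ G.feas i x₀ u, G.cost Phat i x₀ u (u i) ≤ G.cost Phat i x₀ u v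

/-- `Xf` is forward invariant for `x ↦ (A + ∑ i, B i K i) x` and constraints-admissible, i.e. the
states in `Xf` and the inputs `K i x` generated on it satisfy the constraints. -/
def IsAdmissibleInvariant (K : Fin N → Matrix (Fin m) (Fin n) ℝ) (Xf : Set (Fin n → ℝ)) : Prop :=
  ∀ x ∈ Xf, x ∈ G.X ∧ (∀ i, K i *ᵥ x ∈ G.U i fun j => K j.1 *ᵥ x) ∧ G.closedLoop K *ᵥ x ∈ Xf

/-- The set of states in `X` at which the problem with horizon `T` has a solution that ends
in `Xf`. -/
def solvableSet (T : ℕ) (Phat : Fin N → Matrix (Fin n ⊕ Fin n) (Fin n ⊕ Fin n) ℝ)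
    (Xf : Set (Fin n → ℝ)) : Set (Fin n → ℝ) :=
  {x₀ | x₀ ∈ G.X ∧ ∃ u : Fin N → Fin T → Fin m → ℝ,
    G.SolvesFH Phat x₀ u ∧ G.phi x₀ u (Fin.last T) ∈ Xf}

/-- The shifted sequence: drop the first input and append `K i` times the terminal state. -/
def shift (K : Fin N → Matrix (Fin m) (Fin n) ℝ) (x₀ : Fin n → ℝ)
    (u : Fin N → Fin T → Fin m → ℝ) : Fin N → Fin T → Fin m → ℝ := fun i t =>
  if h : t.1 + 1 < T then u i ⟨t.1 + 1, h⟩ else K i *ᵥ G.phi x₀ u (Fin.last T)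

end LQGame

end

open Matrix

noncomputable section

/-! ### Quadratic forms -/

theorem wsq_add {α : Type*} [Fintype α] {M : Matrix α α ℝ} (hM : Mᵀ = M) (x y : α → ℝ) :
    wsq M (x + y) = wsq M x + wsq M y + 2 * (y ⬝ᵥ (M *ᵥ x)) := by
  have h : x ⬝ᵥ (M *ᵥ y) = y ⬝ᵥ (M *ᵥ x) := by
    conv_lhs => rw [← hM]
    rw [dotProduct_transpose_mulVec]
  simp only [wsq, mulVec_add, add_dotProduct, dotProduct_add, h]
  ring

theorem wsq_mulVec {α β : Type*} [Fintype α] [Fintype β] (M : Matrix α α ℝ) (F : Matrix α β ℝ)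
    (x : β → ℝ) : wsq M (F *ᵥ x) = wsq (Fᵀ * M * F) x := by
  simp only [wsq, ← mulVec_mulVec, Matrix.mul_assoc]
  rw [dotProduct_transpose_mulVec, dotProduct_comm]

theorem wsq_add_left {α : Type*} [Fintype α] (M M' : Matrix α α ℝ) (x : α → ℝ) :
    wsq (M + M') x = wsq M x + wsq M' x := by
  simp [wsq, add_mulVec]

/-- A solution of the discrete algebraic Riccati equation in its closed-loop (Joseph) form. -/
theorem riccati_joseph {α β : Type*} [Fintype α] [Fintype β]
    {A P Q : Matrix α α ℝ} {B : Matrix α β ℝ} {R : Matrix β β ℝ} {K : Matrix β α ℝ}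
    (hK : (R + Bᵀ * P * B) * K = -(Bᵀ * P * A)) (hP : P = Q + Aᵀ * P * (A + B * K)) :
    P = Q + Kᵀ * R * K + (A + B * K)ᵀ * P * (A + B * K) := by
  have h0 : R * K + Bᵀ * P * (A + B * K) = 0 := by
    rw [Matrix.add_mul] at hK
    rw [Matrix.mul_add, eq_neg_iff_add_eq_zero.1 hK |>.symm]
    simp only [Matrix.mul_assoc]
    abel
  calc P = Q + Aᵀ * P * (A + B * K) + Kᵀ * (R * K + Bᵀ * P * (A + B * K)) := by
        rw [h0, Matrix.mul_zero, add_zero]; exact hP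
    _ = _ := by
        rw [transpose_add, transpose_mul]
        generalize A + B * K = F
        simp only [Matrix.mul_add, Matrix.add_mul, Matrix.mul_assoc]
        abel

/-- Completion of the square for the discrete-time linear-quadratic regulator. -/
theorem riccati_complete_square {α β : Type*} [Fintype α] [Fintype β]
    {A P Q : Matrix α α ℝ} {B : Matrix α β ℝ} {R : Matrix β β ℝ} {K : Matrix β α ℝ}
    (hPs : Pᵀ = P) (hRs : Rᵀ = R)
    (hK : (R + Bᵀ * P * B) * K = -(Bᵀ * P * A)) (hP : P = Q + Aᵀ * P * (A + B * K))
    (z : α → ℝ) (u : β → ℝ) :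
    wsq Q z + wsq R u + wsq P (A *ᵥ z + B *ᵥ u) =
      wsq P z + wsq (R + Bᵀ * P * B) (u - K *ᵥ z) := by
  obtain ⟨w, rfl⟩ : ∃ w, u = K *ᵥ z + w := ⟨u - K *ᵥ z, by abel⟩
  have h1 : A *ᵥ z + B *ᵥ (K *ᵥ z + w) = (A + B * K) *ᵥ z + B *ᵥ w := by
    rw [mulVec_add, add_mulVec, mulVec_mulVec, add_assoc]
  have h0 : R * K + Bᵀ * P * (A + B * K) = 0 := by
    rw [Matrix.add_mul] at hK
    rw [Matrix.mul_add, eq_neg_iff_add_eq_zero.1 hK |>.symm]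
    simp only [Matrix.mul_assoc]
    abel
  have h2 : w ⬝ᵥ (R *ᵥ (K *ᵥ z)) + (B *ᵥ w) ⬝ᵥ (P *ᵥ ((A + B * K) *ᵥ z)) = 0 := by
    have : (B *ᵥ w) ⬝ᵥ (P *ᵥ ((A + B * K) *ᵥ z)) =
        w ⬝ᵥ (Bᵀ *ᵥ (P *ᵥ ((A + B * K) *ᵥ z))) := by
      rw [dotProduct_transpose_mulVec, dotProduct_comm]
    rw [this, ← dotProduct_add]
    simp only [mulVec_mulVec, ← add_mulVec]
    rw [← Matrix.mul_assoc, h0]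
    simp
  have h3 : wsq P z = wsq Q z + wsq R (K *ᵥ z) + wsq P ((A + B * K) *ᵥ z) := by
    rw [wsq_mulVec, wsq_mulVec, ← wsq_add_left, ← wsq_add_left, ← riccati_joseph hK hP]
  rw [h1, wsq_add hPs, wsq_add hRs, h3, add_sub_cancel_left, wsq_add_left, ← wsq_mulVec]
  linarith

/-! ### Schur matrices -/

theorem IsSchur.transpose {α : Type*} [Fintype α] [DecidableEq α] {M : Matrix α α ℝ}
    (h : IsSchur M) : IsSchur Mᵀ := by
  intro μ hμ
  refine h μ ?_
  rw [spectrum.mem_iff, isUnit_iff_isUnit_det] at hμ ⊢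
  rwa [← det_transpose, transpose_sub, ← transpose_map, algebraMap_eq_diagonal,
    diagonal_transpose, ← algebraMap_eq_diagonal]

theorem Matrix.mem_spectrum_iff_exists_mulVec {α : Type*} [Fintype α] [DecidableEq α]
    (M : Matrix α α ℂ) (μ : ℂ) : μ ∈ spectrum ℂ M ↔ ∃ v, v ≠ 0 ∧ M *ᵥ v = μ • v := by
  rw [spectrum.mem_iff, isUnit_iff_isUnit_det, isUnit_iff_ne_zero, not_not,
    ← exists_mulVec_eq_zero_iff]
  refine exists_congr fun v => and_congr_right fun _ => ?_
  rw [sub_mulVec, sub_eq_zero, eq_comm, Algebra.algebraMap_eq_smul_one, smul_mulVec, one_mulVec]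

open Filter Topology in
/-- Powers of a Schur matrix tend to zero. -/
theorem IsSchur.tendsto_pow {α : Type*} [Fintype α] [DecidableEq α] {M : Matrix α α ℝ}
    (h : IsSchur M) :
    Tendsto (fun k : ℕ => (M.map (algebraMap ℝ ℂ)) ^ k) atTop (𝓝 0) := by
  let _ : NormedRing (Matrix α α ℂ) := Matrix.linftyOpNormedRing
  let _ : NormedAlgebra ℂ (Matrix α α ℂ) := Matrix.linftyOpNormedAlgebra
  have : CompleteSpace (Matrix α α ℂ) := FiniteDimensional.complete ℂ _
  rcases isEmpty_or_nonempty α with hα | hα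
  · exact tendsto_const_nhds.congr fun k => Subsingleton.elim _ _
  set a := M.map (algebraMap ℝ ℂ)
  have hr : spectralRadius ℂ a < (1 : NNReal) :=
    spectrum.spectralRadius_lt_of_forall_lt a fun z hz => by
      have := h z hz
      exact_mod_cast this
  obtain ⟨r, hr1, hr2⟩ := exists_between hr
  lift r to NNReal using ne_top_of_lt hr2
  have hr2 : r < 1 := by exact_mod_cast hr2
  have hev := (spectrum.pow_nnnorm_pow_one_div_tendsto_nhds_spectralRadius a).eventually_lt_const hr1
  refine tendsto_zero_iff_norm_tendsto_zero.2 (squeeze_zero' (Eventually.of_forall fun _ => norm_nonneg _) ?_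
    (tendsto_pow_atTop_nhds_zero_of_lt_one r.2 (by exact_mod_cast hr2)))
  filter_upwards [hev, eventually_gt_atTop 0] with k hk hk0
  have hk' : (‖a ^ k‖₊ : ENNReal) ≤ (r : ENNReal) ^ k := by
    have := ENNReal.rpow_le_rpow hk.le (Nat.cast_nonneg (α := ℝ) k)
    rwa [← ENNReal.rpow_mul, one_div_mul_cancel (by positivity), ENNReal.rpow_one,
      ENNReal.rpow_natCast] at this
  have : ‖a ^ k‖₊ ≤ r ^ k := by exact_mod_cast hk'
  exact_mod_cast this

open Filter Topology in
/-- The Stein equation `D = X D Y` with Schur coefficients has only the trivial solution. -/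
theorem IsSchur.eq_zero_of_mul_mul_eq {α : Type*} [Fintype α] [DecidableEq α]
    {X Y D : Matrix α α ℝ} (hX : IsSchur X) (hY : IsSchur Y) (hD : D = X * D * Y) : D = 0 := by
  let f := algebraMap ℝ ℂ
  have hpow : ∀ k : ℕ, D.map f = (X.map f) ^ k * D.map f * (Y.map f) ^ k := by
    intro k
    induction k with
    | zero => simp
    | succ k ih =>
      have h1 : D.map f = X.map f * D.map f * Y.map f := by
        conv_lhs => rw [hD]
        rw [Matrix.map_mul, Matrix.map_mul]
      conv_lhs => rw [ih, h1]
      rw [pow_succ, pow_succ']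
      simp only [mul_assoc]
  have hlim : Tendsto (fun k : ℕ => (X.map f) ^ k * D.map f * (Y.map f) ^ k) atTop
      (𝓝 (0 * D.map f * 0)) := (hX.tendsto_pow.mul tendsto_const_nhds).mul hY.tendsto_pow
  have h0 : D.map f = 0 := by
    have := tendsto_nhds_unique (tendsto_const_nhds.congr hpow) hlim
    simpa using this
  ext a b
  have := congrFun (congrFun h0 a) b
  simpa [f] using this

open scoped ComplexOrder in
/-- A positive semidefinite solution of the Riccati equation is stabilizing under
detectability. -/
theorem IsSchur.of_riccati {n m p : ℕ} {A P F : Matrix (Fin n) (Fin n) ℝ}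
    {B : Matrix (Fin n) (Fin m) ℝ} {C : Matrix (Fin p) (Fin n) ℝ}
    {R : Matrix (Fin m) (Fin m) ℝ} {K : Matrix (Fin m) (Fin n) ℝ}
    (hdet : IsDetectable A C) (hR : R.PosDef) (hPp : P.PosSemidef) (hF : F = A + B * K)
    (hP : P = Cᵀ * C + Kᵀ * R * K + Fᵀ * P * F) : IsSchur F := by
  obtain ⟨L, hL⟩ := hdet
  obtain ⟨Z, hZ⟩ : ∃ Z : Matrix (Fin n) (Fin n) ℝ, P = Zᵀ * Z := by
    open scoped MatrixOrder in
    obtain ⟨Z, hZ⟩ := CStarAlgebra.nonneg_iff_eq_star_mul_self.mp hPp.nonneg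
    exact ⟨Z, by simpa [star_eq_conjTranspose] using hZ⟩
  obtain ⟨Y, hY⟩ : ∃ Y : Matrix (Fin m) (Fin m) ℝ, R = Yᵀ * Y := by
    open scoped MatrixOrder in
    obtain ⟨Z, hZ⟩ := CStarAlgebra.nonneg_iff_eq_star_mul_self.mp hR.posSemidef.nonneg
    exact ⟨Z, by simpa [star_eq_conjTranspose] using hZ⟩
  let f := algebraMap ℝ ℂ
  have key : ∀ v : Fin n → ℂ, star (Z.map f *ᵥ v) ⬝ᵥ (Z.map f *ᵥ v) =
      star (C.map f *ᵥ v) ⬝ᵥ (C.map f *ᵥ v) +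
      star ((Y * K).map f *ᵥ v) ⬝ᵥ ((Y * K).map f *ᵥ v) +
      star (Z.map f *ᵥ (F.map f *ᵥ v)) ⬝ᵥ (Z.map f *ᵥ (F.map f *ᵥ v)) := by
    have hq : ∀ {k : ℕ} (E : Matrix (Fin k) (Fin n) ℝ) (v : Fin n → ℂ),
        star (E.map f *ᵥ v) ⬝ᵥ (E.map f *ᵥ v) = star v ⬝ᵥ ((Eᵀ * E).map f *ᵥ v) := by
      intro k E v
      have : (E.map f)ᴴ = Eᵀ.map f := by
        ext a b
        simp [f]
      rw [star_mulVec, ← dotProduct_mulVec, this, mulVec_mulVec, Matrix.map_mul]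
    intro v
    rw [mulVec_mulVec (M := Z.map f), ← Matrix.map_mul, hq, hq, hq, hq, ← dotProduct_add,
      ← dotProduct_add, ← add_mulVec, ← add_mulVec, ← Matrix.map_add, ← Matrix.map_add]
    · congr 3
      rw [← hZ]
      conv_lhs => rw [hP, hZ, hY]
      simp only [transpose_mul, Matrix.mul_assoc]
    all_goals simp
  intro μ hμ
  by_contra! hμ1
  obtain ⟨v, hv0, hv⟩ := (mem_spectrum_iff_exists_mulVec _ μ).1 hμ
  have hnn : ∀ {k : ℕ} (w : Fin k → ℂ), 0 ≤ (star w ⬝ᵥ w).re :=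
    fun w => (Complex.nonneg_iff.1 (dotProduct_star_self_nonneg w)).1
  have hz : ∀ {k : ℕ} (w : Fin k → ℂ), (star w ⬝ᵥ w).re = 0 → w = 0 := by
    intro k w hw
    have h1 := (Complex.nonneg_iff.1 (dotProduct_star_self_nonneg w)).2
    exact dotProduct_star_self_eq_zero.1 (Complex.ext hw h1.symm)
  have hk := congrArg Complex.re (key v)
  have hsm : (star (Z.map f *ᵥ (F.map f *ᵥ v)) ⬝ᵥ (Z.map f *ᵥ (F.map f *ᵥ v))).re =
      ‖μ‖ ^ 2 * (star (Z.map f *ᵥ v) ⬝ᵥ (Z.map f *ᵥ v)).re := by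
    rw [show F.map f *ᵥ v = μ • v from hv, mulVec_smul, star_smul, smul_dotProduct,
      dotProduct_smul, smul_smul, smul_eq_mul]
    have : star μ * μ = ((‖μ‖ ^ 2 : ℝ) : ℂ) := by
      rw [mul_comm]; simpa using Complex.mul_conj' μ
    rw [this, Complex.re_ofReal_mul]
  rw [Complex.add_re, Complex.add_re, hsm] at hk
  have hge : (star (Z.map f *ᵥ v) ⬝ᵥ (Z.map f *ᵥ v)).re ≤
      ‖μ‖ ^ 2 * (star (Z.map f *ᵥ v) ⬝ᵥ (Z.map f *ᵥ v)).re :=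
    le_mul_of_one_le_left (hnn _) (one_le_pow₀ hμ1)
  have hC : C.map f *ᵥ v = 0 := hz _ (by
    linarith [hnn (C.map f *ᵥ v), hnn ((Y * K).map f *ᵥ v)])
  have hYK : (Y * K).map f *ᵥ v = 0 := hz _ (by
    linarith [hnn (C.map f *ᵥ v), hnn ((Y * K).map f *ᵥ v)])
  have hKv : K.map f *ᵥ v = 0 := by
    have h1 : (R * K).map f *ᵥ v = 0 := by
      rw [hY, Matrix.mul_assoc, Matrix.map_mul, ← mulVec_mulVec, hYK, mulVec_zero]
    have h2 : K = R⁻¹ * (R * K) := by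
      rw [← Matrix.mul_assoc, nonsing_inv_mul _ ((isUnit_iff_isUnit_det _).1 hR.isUnit),
        Matrix.one_mul]
    rw [h2, Matrix.map_mul, ← mulVec_mulVec, h1, mulVec_zero]
  refine absurd (hL μ ((mem_spectrum_iff_exists_mulVec _ μ).2 ⟨v, hv0, ?_⟩)) (not_lt.2 hμ1)
  have hA : (A + L * C).map f *ᵥ v = F.map f *ᵥ v := by
    have e1 : (A + L * C).map f = A.map f + L.map f * C.map f := by
      rw [Matrix.map_add _ (map_add f), Matrix.map_mul]
    have e2 : F.map f = A.map f + B.map f * K.map f := by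
      rw [hF, Matrix.map_add _ (map_add f), Matrix.map_mul]
    rw [e1, e2, add_mulVec, add_mulVec, ← mulVec_mulVec, ← mulVec_mulVec, hC, hKv]
    simp
  exact hA.trans hv
namespace LQGame

variable {n m N : ℕ} (G : LQGame n m N)

/-! ### The lifted regulator problem -/

theorem lifted_weight_posDef {K : Fin N → Matrix (Fin m) (Fin n) ℝ} {i : Fin N}
    {Phat : Matrix (Fin n ⊕ Fin n) (Fin n ⊕ Fin n) ℝ}
    (hR : (G.R i).PosDef) (h : G.SolvesLiftedARE K i Phat) :
    (G.R i + (G.liftB i)ᵀ * Phat * G.liftB i).PosDef := by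
  refine hR.add_posSemidef ?_
  simpa using h.1.conjTranspose_mul_mul_same (G.liftB i)

theorem lifted_weight_mul_gain {K : Fin N → Matrix (Fin m) (Fin n) ℝ} {i : Fin N}
    {Phat : Matrix (Fin n ⊕ Fin n) (Fin n ⊕ Fin n) ℝ}
    (hR : (G.R i).PosDef) (h : G.SolvesLiftedARE K i Phat) :
    (G.R i + (G.liftB i)ᵀ * Phat * G.liftB i) * G.liftGain K i Phat =
      -((G.liftB i)ᵀ * Phat * G.liftA K i) := by
  have hu := (isUnit_iff_isUnit_det _).1 (G.lifted_weight_posDef hR h).isUnit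
  rw [liftGain, Matrix.mul_neg, ← Matrix.mul_assoc, ← Matrix.mul_assoc, ← Matrix.mul_assoc,
    mul_nonsing_inv _ hu, Matrix.one_mul]

theorem stage_add_termCost {K : Fin N → Matrix (Fin m) (Fin n) ℝ} {i : Fin N}
    {Phat : Matrix (Fin n ⊕ Fin n) (Fin n ⊕ Fin n) ℝ}
    (hR : (G.R i).PosDef) (h : G.SolvesLiftedARE K i Phat) (x y : Fin n → ℝ) (w : Fin m → ℝ) :
    G.stage i x w + termCost Phat
        (G.A *ᵥ x + (∑ j ∈ Finset.univ.erase i, G.B j * K j) *ᵥ y + G.B i *ᵥ w)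
        (G.closedLoop K *ᵥ y) =
      termCost Phat x y + 1 / 2 * wsq (G.R i + (G.liftB i)ᵀ * Phat * G.liftB i)
        (w - G.liftGain K i Phat *ᵥ Sum.elim x y) := by
  have hPs : Phatᵀ = Phat := by simpa using h.1.isHermitian.eq
  have hRs : (G.R i)ᵀ = G.R i := by simpa using hR.isHermitian.eq
  have hsq := riccati_complete_square hPs hRs (G.lifted_weight_mul_gain hR h) h.2
    (Sum.elim x y) w
  have hz : G.liftA K i *ᵥ Sum.elim x y + G.liftB i *ᵥ w =
      Sum.elim (G.A *ᵥ x + (∑ j ∈ Finset.univ.erase i, G.B j * K j) *ᵥ y + G.B i *ᵥ w)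
        (G.closedLoop K *ᵥ y) := by
    rw [liftA, liftB, fromBlocks_mulVec, fromRows_mulVec]
    ext (a | a) <;> simp
  have hQ : wsq (G.liftQ i) (Sum.elim x y) = wsq (G.Q i) x := by
    rw [wsq, liftQ, fromBlocks_mulVec]
    simp [wsq, Function.comp_def]
  rw [hz, hQ] at hsq
  rw [stage, termCost, termCost]
  linarith

/-- On the diagonal, the optimal gain of the lifted regulator is the open-loop Nash gain. -/
theorem liftGain_mul_diag {P : Fin N → Matrix (Fin n) (Fin n) ℝ}
    {K : Fin N → Matrix (Fin m) (Fin n) ℝ} {i : Fin N}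
    {Phat : Matrix (Fin n ⊕ Fin n) (Fin n ⊕ Fin n) ℝ}
    (hQ : G.Q i = (G.C i)ᵀ * G.C i) (hR : (G.R i).PosDef) (hdet : IsDetectable G.A (G.C i))
    (hPK : G.SolvesRiccatiOL P K) (hstab : IsSchur (G.closedLoop K))
    (h : G.SolvesLiftedARE K i Phat) :
    G.liftGain K i Phat * (fromRows 1 1 : Matrix (Fin n ⊕ Fin n) (Fin n) ℝ) = K i := by
  have hPs : Phatᵀ = Phat := by simpa using h.1.isHermitian.eq
  have hRs : (G.R i)ᵀ = G.R i := by simpa using hR.isHermitian.eq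
  have hW := G.lifted_weight_posDef hR h
  have hgain := G.lifted_weight_mul_gain hR h
  have hare := h.2
  set I₁ : Matrix (Fin n ⊕ Fin n) (Fin n) ℝ := fromRows 1 0 with hI₁
  set J : Matrix (Fin n ⊕ Fin n) (Fin n) ℝ := fromRows 1 1 with hJ
  set Khat := G.liftGain K i Phat
  set P₁ := I₁ᵀ * Phat * I₁ with hP₁
  set M := I₁ᵀ * Phat * J with hM
  set F := G.closedLoop K with hF
  have hB : G.liftB i = I₁ * G.B i := by
    rw [liftB, hI₁, fromRows_mul]; simp
  have hAI : G.liftA K i * I₁ = I₁ * G.A := by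
    rw [liftA, hI₁, fromBlocks_mul_fromRows, fromRows_mul]; simp
  have hAJ : G.liftA K i * J = J * F - I₁ * (G.B i * K i) := by
    have : F = G.A + ((∑ j ∈ Finset.univ.erase i, G.B j * K j) + G.B i * K i) := by
      rw [Finset.sum_erase_add _ _ (Finset.mem_univ i)]; rfl
    rw [liftA, hI₁, hJ, fromBlocks_mul_fromRows, fromRows_mul, fromRows_mul]
    ext (a | a) b
    · simp only [Matrix.mul_one, Matrix.one_mul, Matrix.sub_apply, fromRows_apply_inl]
      rw [this]; simp; ring
    · simp [hF]
  have hQI : I₁ᵀ * G.liftQ i * I₁ = G.Q i := by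
    rw [Matrix.mul_assoc, liftQ, hI₁, fromBlocks_mul_fromRows, transpose_fromRows,
      fromCols_mul_fromRows]; simp
  have hQJ : I₁ᵀ * G.liftQ i * J = G.Q i := by
    rw [Matrix.mul_assoc, liftQ, hI₁, hJ, fromBlocks_mul_fromRows, transpose_fromRows,
      fromCols_mul_fromRows]; simp
  have hIA : I₁ᵀ * (G.liftA K i)ᵀ = G.Aᵀ * I₁ᵀ := by
    rw [← transpose_mul, hAI, transpose_mul]
  have hP₁s : P₁ᵀ = P₁ := by
    rw [hP₁]; simp only [transpose_mul, transpose_transpose, hPs, Matrix.mul_assoc]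
  have hWeq : G.R i + (G.liftB i)ᵀ * Phat * G.liftB i = G.R i + (G.B i)ᵀ * P₁ * G.B i := by
    rw [hB, hP₁]; simp only [transpose_mul, Matrix.mul_assoc]
  rw [hWeq] at hW hgain
  have hWu := (isUnit_iff_isUnit_det _).1 hW.isUnit
  -- the standalone regulator problem
  have hK₁ : (G.R i + (G.B i)ᵀ * P₁ * G.B i) * (Khat * I₁) = -((G.B i)ᵀ * P₁ * G.A) := by
    rw [← Matrix.mul_assoc, hgain, Matrix.neg_mul, Matrix.mul_assoc _ (G.liftA K i), hAI, hB, hP₁]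
    simp only [transpose_mul, Matrix.mul_assoc]
  have hare₁ : P₁ = G.Q i + G.Aᵀ * P₁ * (G.A + G.B i * (Khat * I₁)) := by
    calc P₁ = I₁ᵀ * (G.liftQ i + (G.liftA K i)ᵀ * Phat * (G.liftA K i + G.liftB i * Khat)) * I₁ := by
          rw [← hare]
      _ = I₁ᵀ * G.liftQ i * I₁ + (I₁ᵀ * (G.liftA K i)ᵀ) * Phat *
            (G.liftA K i * I₁ + G.liftB i * Khat * I₁) := by
          simp only [Matrix.mul_add, Matrix.add_mul, Matrix.mul_assoc]
      _ = _ := by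
          rw [hQI, hIA, hAI, hB, hP₁]
          simp only [Matrix.mul_add, Matrix.mul_assoc]
  have hS : IsSchur (G.A + G.B i * (Khat * I₁)) := by
    refine IsSchur.of_riccati hdet hR ?_ rfl (hQ ▸ riccati_joseph hK₁ hare₁)
    simpa using h.1.conjTranspose_mul_mul_same I₁
  -- the equations along the diagonal
  have hL : (G.R i + (G.B i)ᵀ * P₁ * G.B i) * (Khat * J) =
      -((G.B i)ᵀ * (M * F - P₁ * (G.B i * K i))) := by
    rw [← Matrix.mul_assoc, hgain, Matrix.neg_mul, Matrix.mul_assoc _ (G.liftA K i), hAJ, hB, hP₁, hM]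
    simp only [transpose_mul, Matrix.mul_assoc, Matrix.mul_sub]
  have hareM : M = G.Q i + G.Aᵀ * (M * F + P₁ * (G.B i * (Khat * J - K i))) := by
    calc M = I₁ᵀ * (G.liftQ i + (G.liftA K i)ᵀ * Phat * (G.liftA K i + G.liftB i * Khat)) * J := by
          rw [← hare]
      _ = I₁ᵀ * G.liftQ i * J + (I₁ᵀ * (G.liftA K i)ᵀ) * Phat *
            (G.liftA K i * J + G.liftB i * Khat * J) := by
          simp only [Matrix.mul_add, Matrix.add_mul, Matrix.mul_assoc]
      _ = _ := by
          rw [hQJ, hIA, hAJ, hB, hP₁, hM]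
          simp only [Matrix.mul_add, Matrix.mul_sub, Matrix.mul_assoc]
          abel
  have hRK : G.R i * K i = -((G.B i)ᵀ * (P i * F)) := by
    have hRu := (isUnit_iff_isUnit_det _).1 hR.isUnit
    rw [(hPK i).2, Matrix.mul_neg, ← Matrix.mul_assoc, ← Matrix.mul_assoc, ← Matrix.mul_assoc,
      mul_nonsing_inv _ hRu, Matrix.one_mul, Matrix.mul_assoc]
  have hE : (G.R i + (G.B i)ᵀ * P₁ * G.B i) * (Khat * J - K i) =
      -((G.B i)ᵀ * ((M - P i) * F)) := by
    rw [Matrix.mul_sub, hL, Matrix.add_mul, hRK]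
    simp only [Matrix.mul_sub, Matrix.sub_mul, Matrix.mul_assoc]
    abel
  have hD : M - P i = G.Aᵀ * ((M - P i) * F + P₁ * (G.B i * (Khat * J - K i))) := by
    have h1 := (hPK i).1
    calc M - P i = (G.Q i + G.Aᵀ * (M * F + P₁ * (G.B i * (Khat * J - K i)))) -
          (G.Q i + G.Aᵀ * P i * F) := by rw [← hareM, ← h1]
      _ = _ := by
        generalize Khat * J - K i = E
        simp only [Matrix.mul_add, Matrix.sub_mul, Matrix.mul_sub, Matrix.mul_assoc]
        abel
  have hKW : (Khat * I₁)ᵀ * (G.R i + (G.B i)ᵀ * P₁ * G.B i) = -(G.Aᵀ * (P₁ * G.B i)) := by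
    have := congrArg transpose hK₁
    simpa only [transpose_mul, transpose_add, transpose_neg, transpose_transpose, hP₁s, hRs,
      Matrix.mul_assoc] using this
  have hDfix : M - P i = (G.A + G.B i * (Khat * I₁))ᵀ * (M - P i) * F := by
    have h1 : (Khat * I₁)ᵀ * ((G.B i)ᵀ * ((M - P i) * F)) =
        G.Aᵀ * (P₁ * (G.B i * (Khat * J - K i))) := by
      rw [← neg_inj, ← Matrix.mul_neg, ← hE, ← Matrix.mul_assoc, hKW]
      simp only [Matrix.neg_mul, Matrix.mul_assoc]
    calc M - P i = G.Aᵀ * ((M - P i) * F) + G.Aᵀ * (P₁ * (G.B i * (Khat * J - K i))) := by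
          rw [← Matrix.mul_add]; exact hD
      _ = _ := by
          rw [← h1, transpose_add, transpose_mul (G.B i)]
          simp only [Matrix.add_mul, Matrix.mul_assoc]
  have hzero : M - P i = 0 := hS.transpose.eq_zero_of_mul_mul_eq hstab hDfix
  rw [hzero, Matrix.zero_mul, Matrix.mul_zero, neg_zero] at hE
  have : Khat * J - K i = 0 := by
    rw [← Matrix.one_mul (Khat * J - K i), ← nonsing_inv_mul _ hWu, Matrix.mul_assoc, hE,
      Matrix.mul_zero]
  exact sub_eq_zero.1 this

theorem liftGain_mulVec_diag {P : Fin N → Matrix (Fin n) (Fin n) ℝ}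
    {K : Fin N → Matrix (Fin m) (Fin n) ℝ} {i : Fin N}
    {Phat : Matrix (Fin n ⊕ Fin n) (Fin n ⊕ Fin n) ℝ}
    (hQ : G.Q i = (G.C i)ᵀ * G.C i) (hR : (G.R i).PosDef) (hdet : IsDetectable G.A (G.C i))
    (hPK : G.SolvesRiccatiOL P K) (hstab : IsSchur (G.closedLoop K))
    (h : G.SolvesLiftedARE K i Phat) (y : Fin n → ℝ) :
    G.liftGain K i Phat *ᵥ Sum.elim y y = K i *ᵥ y := by
  rw [← G.liftGain_mul_diag hQ hR hdet hPK hstab h, ← mulVec_mulVec, fromRows_mulVec]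
  simp

/-! ### Shifting trajectories -/

section Shift

variable {k : ℕ}

@[simp] theorem phi_zero {T : ℕ} (x₀ : Fin n → ℝ) (u : Fin N → Fin T → Fin m → ℝ) :
    G.phi x₀ u 0 = x₀ := rfl

theorem phi_succ {T : ℕ} (x₀ : Fin n → ℝ) (u : Fin N → Fin T → Fin m → ℝ) (t : Fin T) :
    G.phi x₀ u t.succ = G.A *ᵥ G.phi x₀ u t.castSucc + ∑ i, G.B i *ᵥ u i t :=
  Fin.induction_succ _ _ _

theorem phi_tail (x₀ : Fin n → ℝ) {u w : Fin N → Fin (k + 1) → Fin m → ℝ}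
    (h : ∀ j (t : Fin k), w j t.castSucc = u j t.succ) (t : Fin (k + 1)) :
    G.phi (G.phi x₀ u 1) w t.castSucc = G.phi x₀ u t.succ := by
  induction t using Fin.induction with
  | zero => rfl
  | succ s ih =>
    rw [← Fin.succ_castSucc, phi_succ, ih, phi_succ (t := s.succ), ← Fin.succ_castSucc]
    simp only [h]

theorem shift_castSucc (K : Fin N → Matrix (Fin m) (Fin n) ℝ) (x₀ : Fin n → ℝ)
    (u : Fin N → Fin (k + 1) → Fin m → ℝ) (i : Fin N) (t : Fin k) :
    G.shift K x₀ u i t.castSucc = u i t.succ := by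
  simp [shift, Fin.succ]

theorem shift_last (K : Fin N → Matrix (Fin m) (Fin n) ℝ) (x₀ : Fin n → ℝ)
    (u : Fin N → Fin (k + 1) → Fin m → ℝ) (i : Fin N) :
    G.shift K x₀ u i (Fin.last k) = K i *ᵥ G.phi x₀ u (Fin.last (k + 1)) := by
  simp [shift]

theorem phi_shift_last (K : Fin N → Matrix (Fin m) (Fin n) ℝ) (x₀ : Fin n → ℝ)
    (u : Fin N → Fin (k + 1) → Fin m → ℝ) :
    G.phi (G.phi x₀ u 1) (G.shift K x₀ u) (Fin.last (k + 1)) =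
      G.closedLoop K *ᵥ G.phi x₀ u (Fin.last (k + 1)) := by
  rw [← Fin.succ_last, phi_succ, G.phi_tail x₀ (G.shift_castSucc K x₀ u)]
  simp only [shift_last, Fin.succ_last, closedLoop, add_mulVec, sum_mulVec, mulVec_mulVec]

/-- Prepend the first input of agent `i` to a sequence for the shifted problem, and drop the last
input. -/
def prepend (u : Fin N → Fin (k + 1) → Fin m → ℝ) (i : Fin N) (v : Fin (k + 1) → Fin m → ℝ) :
    Fin (k + 1) → Fin m → ℝ :=
  Fin.cons (u i 0) fun t : Fin k => v t.castSucc

theorem prepend_shift (K : Fin N → Matrix (Fin m) (Fin n) ℝ) (x₀ : Fin n → ℝ)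
    (u : Fin N → Fin (k + 1) → Fin m → ℝ) (i : Fin N) :
    prepend u i (G.shift K x₀ u i) = u i := by
  ext t : 1
  induction t using Fin.cases <;> simp [prepend, shift_castSucc]

theorem phi_update_prepend_one (x₀ : Fin n → ℝ) (u : Fin N → Fin (k + 1) → Fin m → ℝ)
    (i : Fin N) (v : Fin (k + 1) → Fin m → ℝ) :
    G.phi x₀ (Function.update u i (prepend u i v)) 1 = G.phi x₀ u 1 := by
  rw [← Fin.succ_zero_eq_one, phi_succ, phi_succ]
  congr 1
  refine Finset.sum_congr rfl fun j _ => ?_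
  rcases eq_or_ne j i with rfl | hj
  · simp [prepend]
  · simp [hj]

theorem phi_update_shift (K : Fin N → Matrix (Fin m) (Fin n) ℝ) (x₀ : Fin n → ℝ)
    (u : Fin N → Fin (k + 1) → Fin m → ℝ) (i : Fin N) (v : Fin (k + 1) → Fin m → ℝ)
    (t : Fin (k + 1)) :
    G.phi (G.phi x₀ u 1) (Function.update (G.shift K x₀ u) i v) t.castSucc =
      G.phi x₀ (Function.update u i (prepend u i v)) t.succ := by
  rw [← G.phi_update_prepend_one x₀ u i v]
  refine G.phi_tail x₀ (fun j t => ?_) t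
  rcases eq_or_ne j i with rfl | hj
  · simp [prepend]
  · simp [hj, shift_castSucc]

theorem phi_update_shift_last (K : Fin N → Matrix (Fin m) (Fin n) ℝ) (x₀ : Fin n → ℝ)
    (u : Fin N → Fin (k + 1) → Fin m → ℝ) (i : Fin N) (v : Fin (k + 1) → Fin m → ℝ) :
    G.phi (G.phi x₀ u 1) (Function.update (G.shift K x₀ u) i v) (Fin.last (k + 1)) =
      G.A *ᵥ G.phi x₀ (Function.update u i (prepend u i v)) (Fin.last (k + 1)) +
        (∑ j ∈ Finset.univ.erase i, G.B j * K j) *ᵥ G.phi x₀ u (Fin.last (k + 1)) +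
        G.B i *ᵥ v (Fin.last k) := by
  rw [← Fin.succ_last, phi_succ, phi_update_shift, ← Finset.sum_erase_add _ _ (Finset.mem_univ i),
    ← add_assoc, Function.update_self, sum_mulVec, Fin.succ_last]
  congr 2
  refine Finset.sum_congr rfl fun j hj => ?_
  rw [Function.update_of_ne (Finset.ne_of_mem_erase hj), shift_last, mulVec_mulVec]

theorem cost_shift {K : Fin N → Matrix (Fin m) (Fin n) ℝ} {i : Fin N}
    {Phat : Fin N → Matrix (Fin n ⊕ Fin n) (Fin n ⊕ Fin n) ℝ}
    (hR : (G.R i).PosDef) (h : G.SolvesLiftedARE K i (Phat i)) (x₀ : Fin n → ℝ)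
    (u : Fin N → Fin (k + 1) → Fin m → ℝ) (v : Fin (k + 1) → Fin m → ℝ) :
    G.stage i x₀ (u i 0) + G.cost Phat i (G.phi x₀ u 1) (G.shift K x₀ u) v =
      G.cost Phat i x₀ u (prepend u i v) +
        1 / 2 * wsq (G.R i + (G.liftB i)ᵀ * Phat i * G.liftB i)
          (v (Fin.last k) - G.liftGain K i (Phat i) *ᵥ
            Sum.elim (G.phi x₀ (Function.update u i (prepend u i v)) (Fin.last (k + 1)))
              (G.phi x₀ u (Fin.last (k + 1)))) := by
  have hb := G.stage_add_termCost hR h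
    (G.phi x₀ (Function.update u i (prepend u i v)) (Fin.last (k + 1)))
    (G.phi x₀ u (Fin.last (k + 1))) (v (Fin.last k))
  rw [cost, cost, Fin.sum_univ_castSucc, Fin.sum_univ_succ, phi_update_shift_last,
    phi_shift_last]
  simp only [phi_update_shift, Fin.castSucc_zero, phi_zero, ← Fin.succ_castSucc, Fin.succ_last]
  have h0 : prepend u i v 0 = u i 0 := rfl
  have hs : ∀ t : Fin k, prepend u i v t.succ = v t.castSucc := fun t => rfl
  simp only [h0, hs]
  linarith

theorem prepend_mem_feas {K : Fin N → Matrix (Fin m) (Fin n) ℝ} {x₀ : Fin n → ℝ} {i : Fin N}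
    {u : Fin N → Fin (k + 1) → Fin m → ℝ} (hu : u i ∈ G.feas i x₀ u)
    {v : Fin (k + 1) → Fin m → ℝ} (hv : v ∈ G.feas i (G.phi x₀ u 1) (G.shift K x₀ u)) :
    prepend u i v ∈ G.feas i x₀ u := by
  refine ⟨fun t => ?_, fun t => ?_⟩
  · induction t using Fin.cases with
    | zero => exact hu.1 0
    | succ s => simpa [prepend, shift_castSucc] using hv.1 s.castSucc
  · induction t using Fin.cases with
    | zero =>
      have := hu.2 0
      rw [Function.update_eq_self] at this
      rw [Fin.succ_zero_eq_one] at this ⊢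
      rwa [phi_update_prepend_one]
    | succ s =>
      rw [← G.phi_update_shift K, ← Fin.succ_castSucc]
      exact hv.2 s.castSucc

theorem shift_mem_feas {K : Fin N → Matrix (Fin m) (Fin n) ℝ} {Xf : Set (Fin n → ℝ)}
    (hXf : G.IsAdmissibleInvariant K Xf) {x₀ : Fin n → ℝ} {i : Fin N}
    {u : Fin N → Fin (k + 1) → Fin m → ℝ} (hu : u i ∈ G.feas i x₀ u)
    (hterm : G.phi x₀ u (Fin.last (k + 1)) ∈ Xf) :
    G.shift K x₀ u i ∈ G.feas i (G.phi x₀ u 1) (G.shift K x₀ u) := by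
  obtain ⟨-, hU, hinv⟩ := hXf _ hterm
  refine ⟨fun t => ?_, fun t => ?_⟩
  · induction t using Fin.lastCases with
    | last => simpa only [shift_last] using hU i
    | cast s => simpa only [shift_castSucc] using hu.1 s.succ
  · rw [Function.update_eq_self]
    induction t using Fin.lastCases with
    | last =>
      rw [Fin.succ_last, phi_shift_last]
      exact (hXf _ hinv).1
    | cast s =>
      rw [Fin.succ_castSucc, G.phi_tail x₀ (G.shift_castSucc K x₀ u)]
      simpa only [Function.update_eq_self] using hu.2 s.succ

end Shift

end LQGame

end
theorem mainTheorem7 {n m N T : ℕ} (hN : 0 < N) (hT : 0 < T) (G : LQGame n m N)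
    (hbasic : G.Basic) (hprim : G.Primitives) (hH : G.StructureH)
    (P : Fin N → Matrix (Fin n) (Fin n) ℝ) (K : Fin N → Matrix (Fin m) (Fin n) ℝ)
    (hPK : G.SolvesRiccatiOL P K) (hstab : IsSchur (G.closedLoop K))
    (Phat : Fin N → Matrix (Fin n ⊕ Fin n) (Fin n ⊕ Fin n) ℝ)
    (hPhat : ∀ i, G.SolvesLiftedARE K i (Phat i))
    (Xf : Set (Fin n → ℝ)) (hXf : G.IsAdmissibleInvariant K Xf)
    (x₀ : Fin n → ℝ) (hx₀ : x₀ ∈ G.solvableSet T Phat Xf)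
    (uFH : Fin N → Fin T → Fin m → ℝ) (huFH : G.SolvesFH Phat x₀ uFH)
    (hterm : G.phi x₀ uFH (Fin.last T) ∈ Xf) :
    G.phi x₀ uFH ⟨1, Nat.succ_lt_succ hT⟩ ∈ G.X ∧
      G.SolvesFH Phat (G.phi x₀ uFH ⟨1, Nat.succ_lt_succ hT⟩) (G.shift K x₀ uFH) := by
  obtain ⟨k, rfl⟩ := Nat.exists_eq_succ_of_ne_zero hT.ne'
  have h1 : (⟨1, Nat.succ_lt_succ hT⟩ : Fin (k + 1 + 1)) = 1 := rfl
  rw [h1]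
  refine ⟨?_, fun i => ⟨G.shift_mem_feas hXf (huFH i).1 hterm, fun v hv => ?_⟩⟩
  · have := (huFH ⟨0, hN⟩).1.2 0
    rwa [Function.update_eq_self] at this
  have hR := hbasic.R_posDef i
  have hmin := (huFH i).2 _ (G.prepend_mem_feas (huFH i).1 hv)
  have hcv := G.cost_shift hR (hPhat i) x₀ uFH v
  have hcs := G.cost_shift hR (hPhat i) x₀ uFH (G.shift K x₀ uFH i)
  rw [LQGame.prepend_shift, Function.update_eq_self, LQGame.shift_last,
    G.liftGain_mulVec_diag (hbasic.Q_eq i) hR (hprim.det i) hPK hstab (hPhat i), sub_self] at hcs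
  have hz : ∀ M : Matrix (Fin m) (Fin m) ℝ, wsq M 0 = 0 := fun M => by simp [wsq]
  rw [hz] at hcs
  have hnn : ∀ w, 0 ≤ wsq (G.R i + (G.liftB i)ᵀ * Phat i * G.liftB i) w := fun w => by
    simpa [wsq] using
      (G.lifted_weight_posDef hR (hPhat i)).posSemidef.dotProduct_mulVec_nonneg w
  linarith [hnn (v (Fin.last k) - G.liftGain K i (Phat i) *ᵥ
    Sum.elim (G.phi x₀ (Function.update uFH i (LQGame.prepend uFH i v)) (Fin.last (k + 1)))
      (G.phi x₀ uFH (Fin.last (k + 1))))]
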